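/- **Conventions.** Let $\mathbf M=(M;F)$ be a finite algebra and let $\mathrm{End}(\mathbf M)$ be the set of its endomorphisms. For $k\ge 1$, $\mathbf M$ is *$k$-endoprimal* if every function $f:M^k\to M$ that commutes with all endomorphisms of $\mathbf M$, i.e. $f(e(x_1),\dots,e(x_k))=e(f(x_1,\dots,x_k))$ for all $e\in\mathrm{End}(\mathbf M)$ and $x_1,\dots,x_k\in M$, is a term function of $\mathbf M$; it is *endoprimal* if it is $k$-endoprimal for every $k\ge1$. Let $\mathrm{ISP}(\mathbf M)$ be the class of all (non-empty) algebras isomorphic to subalgebras of powers of $\mathbf M$. For $\mathbf A\in\mathrm{ISP}(\mathbf M)$ let $D(\mathbf A)\subseteq M^A$ be the set of homomorphisms $\mathbf A\to\mathbf M$, with the topology induced from the product topology on $M^A$, $M$ being discrete. For an $n$-ary relation $r\subseteq M^n$, a map $\varphi:D(\mathbf A)\to M$ *preserves* $r$ if $(\varphi(x_1),\dots,\varphi(x_n))\in r$ whenever $x_1,\dots,x_n\in D(\mathbf A)$ satisfy $(x_1(a),\dots,x_n(a))\in r$ for all $a\in A$; it preserves an operation (in particular, an endomorphism or a constant, i.e.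 a nullary operation) if it preserves its graph. Let $R$ be a set of finitary relations and operations on $M$. We say that $R$ *represents* $\mathrm{ISP}(\mathbf M)$ if for every $\mathbf A\in\mathrm{ISP}(\mathbf M)$ the map $a\mapsto (h\mapsto h(a))$ is a bijection from $A$ onto the set of all continuous maps $D(\mathbf A)\to M$ that preserve every member of $R$. We say that $R$ *yields a duality* on $\mathrm{ISP}(\mathbf M)$ if, moreover, $R$ is algebraic over $\mathbf M$, i.e. all relations in $R$ and all graphs of operations in $R$ are subalgebras of powers of $\mathbf M$. A finite algebra $\mathbf M$ is *endodualisable* if $\mathrm{End}(\mathbf M)$ yields a duality on $\mathrm{ISP}(\mathbf M)$. A *retraction* of $\mathbf M$ onto a subset $S$ is an idempotent endomorphism of $\mathbf M$ with image $S$. **Theorem.** Let $L$ be a finite distributive lattice with at least two elements, with least element $0$ and greatest element $1$. (A) For the algebra $\mathbf L=(L;\vee,\wedge)$ the following are equivalent: 1. $\mathbf L$ is $3$-endoprimal; 2. $\mathbf L$ is endoprimal; 3. $\mathbf L$ is endodualisable; 4. the retractions of $\mathbf L$ onto $\{0,1\}$ together with the constants $0,1$ yield a duality on $\mathrm{ISP}(\mathbf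 L)$; 5. $L$ is not a Boolean lattice. (B) For the algebra $\mathbf L=(L;\vee,\wedge,0,1)$ the following are equivalent: 1. $\mathbf L$ is $1$-endoprimal; 2. $\mathbf L$ is endoprimal; 3. $\mathbf L$ is endodualisable; 4. the retractions of $\mathbf L$ onto $\{0,1\}$ yield a duality on $\mathrm{ISP}(\mathbf L)$; 5. the retractions of $\mathbf L$ onto $\{0,1\}$ together with the constants $0,1$ represent $\mathrm{ISP}(\mathbf L)$; 6. $L$ is not a Boolean lattice. -/

import Mathlib

namespace NaturalDuality

open scoped FirstOrder

universe u

/-! ### Algebras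

An algebra `M = (M; F)` is a structure for a first-order language without relation symbols;
homomorphisms are `A →[ℒ] M` and terms in the variables `x₀, …, xₖ₋₁` are `ℒ.Term (Fin k)`. -/

/-- The power `M ^ I` of an algebra `M`, with the coordinatewise operations. -/
instance (priority := 2000) powerStructure {ℒ : FirstOrder.Language.{0, 0}} {M I : Type*} [ℒ.Structure M] :
    ℒ.Structure (I → M) where
  funMap f x := fun i => FirstOrder.Language.Structure.funMap f (fun j => x j i)
  RelMap r x := ∀ i, FirstOrder.Language.Structure.RelMap r (fun j => x j i)

/-- `A ∈ ISP(M)`: the algebra `A` is isomorphic to a subalgebra of a power of `M`. -/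
def InISP (ℒ : FirstOrder.Language.{0, 0}) (M A : Type u) [ℒ.Structure M] [ℒ.Structure A] : Prop :=
  ∃ I : Type u, Nonempty (A ↪[ℒ] (I → M))

/-! ### Endoprimality -/

/-- A `k`-ary function on `M` is `End(M)`-preserving if it commutes with all endomorphisms. -/
def EndPreserving (ℒ : FirstOrder.Language.{0, 0}) {M : Type u} [ℒ.Structure M] {k : ℕ}
    (f : (Fin k → M) → M) : Prop :=
  ∀ (e : M →[ℒ] M) (x : Fin k → M), f (fun i => e (x i)) = e (f x)

/-- A `k`-ary function on `M` is a term function if it is induced by a term. -/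
def IsTermFunction (ℒ : FirstOrder.Language.{0, 0}) {M : Type u} [ℒ.Structure M] {k : ℕ}
    (f : (Fin k → M) → M) : Prop :=
  ∃ t : ℒ.Term (Fin k), ∀ x : Fin k → M, f x = t.realize x

/-- `k`-endoprimal algebras (used for `k ≥ 1`). -/
def KEndoprimal (ℒ : FirstOrder.Language.{0, 0}) (k : ℕ) (M : Type u) [ℒ.Structure M] : Prop :=
  ∀ f : (Fin k → M) → M, EndPreserving ℒ f → IsTermFunction ℒ f

/-- Endoprimal algebras: `k`-endoprimal for every `k ≥ 1`. -/
def Endoprimal (ℒ : FirstOrder.Language.{0, 0}) (M : Type u) [ℒ.Structure M] : Prop :=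
  ∀ k : ℕ, 1 ≤ k → KEndoprimal ℒ k M

/-! ### Natural dualities

The type `(G, H, R)` of an alter ego of `M` enters only through the relations in `R` and the
graphs of the (partial) operations in `G ∪ H`, so it is a set of finitary relations on `M`. -/

/-- A finitary relation on `M`: an arity `n` and a subset of `M ^ n`. -/
abbrev FinRel (M : Type u) : Type u := Σ n : ℕ, Set (Fin n → M)

/-- The graph `{(x₁, …, xₙ, g(x₁, …, xₙ))}` of an `n`-ary operation `g`. -/
abbrev graph {M : Type u} {n : ℕ} (g : (Fin n → M) → M) : FinRel M :=
  ⟨n + 1, {v | v (Fin.last n) = g (fun i => v i.castSucc)}⟩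

/-- The graph of a unary operation. -/
abbrev unaryGraph {M : Type u} (g : M → M) : FinRel M :=
  graph (n := 1) (fun v => g (v 0))

/-- The graph of a constant, that is, of a nullary operation. -/
abbrev constGraph {M : Type u} (c : M) : FinRel M :=
  graph (n := 0) (fun _ => c)

/-- A finitary relation is algebraic over `M` if it is a subalgebra of a power of `M`. -/
def IsAlgebraicRel (ℒ : FirstOrder.Language.{0, 0}) {M : Type u} [ℒ.Structure M] (r : FinRel M) : Prop :=
  ∃ S : ℒ.Substructure (Fin r.1 → M), (S : Set (Fin r.1 → M)) = r.2

/-- The topology on `D(A) = Hom(A, M)` as a subspace of `M ^ A`, where `M` is discrete. -/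
abbrev dualTopology (ℒ : FirstOrder.Language.{0, 0}) (M A : Type u) [ℒ.Structure M] [ℒ.Structure A] :
    TopologicalSpace (A →[ℒ] M) :=
  TopologicalSpace.induced (fun (h : A →[ℒ] M) (a : A) => h a)
    (@Pi.topologicalSpace A (fun _ => M) (fun _ => ⊥))

/-- A map `φ : D(A) → M`, where `D(A) ⊆ M ^ A`, preserves the finitary relation `r` on `M`. -/
def Preserves (ℒ : FirstOrder.Language.{0, 0}) {M A : Type u} [ℒ.Structure M] [ℒ.Structure A]
    (φ : (A →[ℒ] M) → M) (r : FinRel M) : Prop :=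
  ∀ x : Fin r.1 → (A →[ℒ] M), (∀ a : A, (fun j => x j a) ∈ r.2) → (fun j => φ (x j)) ∈ r.2

/-- `ED(A)`: the continuous maps `D(A) → M` that preserve every relation in `R`. -/
def doubleDual (ℒ : FirstOrder.Language.{0, 0}) {M : Type u} [ℒ.Structure M] (R : Set (FinRel M))
    (A : Type u) [ℒ.Structure A] : Set ((A →[ℒ] M) → M) :=
  {φ | @Continuous (A →[ℒ] M) M (dualTopology ℒ M A) ⊥ φ ∧ ∀ r ∈ R, Preserves ℒ φ r}

/-- For every (non-empty) algebra `A ∈ ISP(M)`, the evaluation map `a ↦ (h ↦ h(a))` is a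
bijection from `A` onto `ED(A)`. (It is always a homomorphism into the power `M ^ D(A)`.) -/
def EvaluationsBijective (ℒ : FirstOrder.Language.{0, 0}) {M : Type u} [ℒ.Structure M]
    (R : Set (FinRel M)) : Prop :=
  ∀ (A : Type u) [ℒ.Structure A] [Nonempty A], InISP ℒ M A →
    Set.BijOn (fun (a : A) (h : A →[ℒ] M) => h a) Set.univ (doubleDual ℒ R A)

/-- `R` yields a (natural) duality on `ISP(M)`: all members of `R` are algebraic over `M`, and
the evaluation map of each `A ∈ ISP(M)` is an isomorphism onto `ED(A)`. -/
def YieldsDuality (ℒ : FirstOrder.Language.{0, 0}) {M : Type u} [ℒ.Structure M]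
    (R : Set (FinRel M)) : Prop :=
  (∀ r ∈ R, IsAlgebraicRel ℒ r) ∧ EvaluationsBijective ℒ R

/-- The graphs of all endomorphisms of `M`. -/
def endGraphs (ℒ : FirstOrder.Language.{0, 0}) (M : Type u) [ℒ.Structure M] : Set (FinRel M) :=
  {r | ∃ e : M →[ℒ] M, r = unaryGraph e}

/-- A (finite) algebra `M` is endodualisable if `End(M)` yields a duality on `ISP(M)`. -/
def Endodualisable (ℒ : FirstOrder.Language.{0, 0}) (M : Type u) [ℒ.Structure M] : Prop :=
  YieldsDuality ℒ (endGraphs ℒ M)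

/-- The graphs of all retractions of `M` onto `S`, that is, of the idempotent endomorphisms
with image `S`. -/
def retractionGraphs (ℒ : FirstOrder.Language.{0, 0}) {M : Type u} [ℒ.Structure M] (S : Set M) :
    Set (FinRel M) :=
  {r | ∃ e : M →[ℒ] M, (∀ x, e (e x) = e x) ∧ Set.range e = S ∧ r = unaryGraph e}

/-! ### Lattices and bounded lattices as algebras -/

/-- Operation symbols of lattices. -/
inductive LatFunc : ℕ → Type
  | sup : LatFunc 2
  | inf : LatFunc 2

/-- Operation symbols of bounded lattices. -/
inductive BddLatFunc : ℕ → Type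
  | sup : BddLatFunc 2
  | inf : BddLatFunc 2
  | zero : BddLatFunc 0
  | one : BddLatFunc 0

/-- The signature `(∨, ∧)`. -/
def latLang : FirstOrder.Language.{0, 0} := ⟨LatFunc, fun _ => Empty⟩

/-- The signature `(∨, ∧, 0, 1)`. -/
def bddLatLang : FirstOrder.Language.{0, 0} := ⟨BddLatFunc, fun _ => Empty⟩

/-- The value of a lattice operation symbol. -/
def latFunMap {L : Type u} [Lattice L] : {n : ℕ} → LatFunc n → (Fin n → L) → L
  | _, .sup, v => v 0 ⊔ v 1
  | _, .inf, v => v 0 ⊓ v 1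

/-- The value of a bounded lattice operation symbol. -/
def bddLatFunMap {L : Type u} [Lattice L] [BoundedOrder L] :
    {n : ℕ} → BddLatFunc n → (Fin n → L) → L
  | _, .sup, v => v 0 ⊔ v 1
  | _, .inf, v => v 0 ⊓ v 1
  | _, .zero, _ => ⊥
  | _, .one, _ => ⊤

/-- A lattice as the algebra `(L; ∨, ∧)`. -/
instance latStructure {L : Type u} [Lattice L] : latLang.Structure L where
  funMap f v := latFunMap f v
  RelMap r _ := r.elim

/-- A bounded lattice as the algebra `(L; ∨, ∧, 0, 1)`. -/
instance bddLatStructure {L : Type u} [Lattice L] [BoundedOrder L] :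
    bddLatLang.Structure L where
  funMap f v := bddLatFunMap f v
  RelMap r _ := r.elim

end NaturalDuality

/-!
A homomorphism `p : L → L` of bounded lattices is called two-valued if it takes no values besides
`⊥` and `⊤`; these are the retractions of `L` onto `{⊥, ⊤}`, they correspond to the prime ideals
of `L`, and they separate the points of `L`. If `φ : D(A) → L` preserves them, then
`p (φ h) = φ (p ∘ h)`, so `φ` is determined by its values on the two-valued homomorphisms
`A → {⊥, ⊤}`, that is, on the points of the Priestley space of `A`.

Suppose that some `c` in `L` has no complement. Then there are two-valued `p ≤ q` with `p c = ⊥`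
and `q c = ⊤` (`exists_twoValued_pair`). If `h ≤ h'` are two-valued on `A`, then
`x = h ⊔ (c ⊓ h')` is a homomorphism with `p ∘ x = h` and `q ∘ x = h'`, whence
`φ h = p (φ x) ≤ q (φ x) = φ h'` (`map_le_map_of_le`). So `φ` is order-preserving and continuous on
the Priestley space, and the compactness argument of Priestley duality (`exists_separating`) shows
that it is an evaluation. The constants only matter where `D(A)` contains constant homomorphisms.
This gives the dualities (`evaluationsBijective_of_not_complementedLattice`), for lattices and for
bounded lattices at once: the argument only needs that the basic operations include `⊔` and `⊓`
and commute with all endomorphisms of the bounded lattice `L`.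

An endodualisable algebra is endoprimal, because the algebra of `k`-ary term functions has dual
`L ^ k`, so that an `End`-preserving function is an element of its double dual
(`Endodualisable.endoprimal`). Finally, if `L` is Boolean, then the complement, for bounded
lattices, and `x + y + z`, for lattices, commute with all endomorphisms but are not monotone,
whereas term functions are.
-/

namespace NaturalDuality

open scoped FirstOrder
open FirstOrder.Language.Structure (funMap)

universe u

/-! ### Two-valued homomorphisms and prime ideals -/

section TwoValued

variable {L : Type u} [DistribLattice L] [BoundedOrder L]

/-- An endomorphism of a bounded lattice with values in `{⊥, ⊤}` only. -/
def TwoValued (e : BoundedLatticeHom L L) : Prop :=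
  ∀ z, e z = ⊥ ∨ e z = ⊤

lemma TwoValued.apply_apply {e : BoundedLatticeHom L L} (he : TwoValued e)
    (e' : BoundedLatticeHom L L) (z : L) : e' (e z) = e z := by
  rcases he z with h | h <;> simp [h]

open Classical in
/-- The two-valued homomorphism whose kernel is a given prime ideal. -/
noncomputable def ofPrime (I : Order.Ideal L) (hI : I.IsPrime) : BoundedLatticeHom L L where
  toFun z := if z ∈ I then ⊥ else ⊤
  map_sup' a b := by
    by_cases ha : a ∈ I <;> by_cases hb : b ∈ I <;> simp [Order.Ideal.sup_mem_iff, ha, hb]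
  map_inf' a b := by
    have h : a ⊓ b ∈ I ↔ a ∈ I ∨ b ∈ I :=
      ⟨hI.mem_or_mem, fun h => h.elim (I.lower inf_le_left) (I.lower inf_le_right)⟩
    by_cases ha : a ∈ I <;> by_cases hb : b ∈ I <;> simp [h, ha, hb]
  map_top' := if_neg hI.toIsProper.top_notMem
  map_bot' := if_pos I.bot_mem

open Classical in
lemma ofPrime_apply (I : Order.Ideal L) (hI : I.IsPrime) (z : L) :
    ofPrime I hI z = if z ∈ I then ⊥ else ⊤ := rfl

lemma twoValued_ofPrime (I : Order.Ideal L) (hI : I.IsPrime) : TwoValued (ofPrime I hI) := by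
  intro z
  by_cases hz : z ∈ I <;> simp [ofPrime_apply, hz]

/-- The two-valued homomorphisms separate points. -/
lemma exists_twoValued_of_not_le {x y : L} (hxy : ¬ x ≤ y) :
    ∃ e : BoundedLatticeHom L L, TwoValued e ∧ e x = ⊤ ∧ e y = ⊥ := by
  obtain ⟨J, hJ, hyJ, hd⟩ := DistribLattice.prime_ideal_of_disjoint_filter_ideal
    (F := Order.PFilter.principal x) (I := Order.Ideal.principal y)
    (Set.disjoint_left.2 fun z hz hz' => hxy (le_trans hz hz'))
  have hx : x ∉ J := Set.disjoint_left.1 hd (le_refl x)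
  have hy : y ∈ J := hyJ (le_refl y)
  exact ⟨ofPrime J hJ, twoValued_ofPrime J hJ, by simp [ofPrime_apply, hx],
    by simp [ofPrime_apply, hy]⟩

lemma eq_of_forall_twoValued [Nontrivial L] {x y : L}
    (h : ∀ e : BoundedLatticeHom L L, TwoValued e → e x = e y) : x = y := by
  apply le_antisymm
  · by_contra hxy
    obtain ⟨e, he, hx, hy⟩ := exists_twoValued_of_not_le hxy
    exact bot_ne_top (α := L) (by rw [← hx, h e he, hy])
  · by_contra hxy
    obtain ⟨e, he, hx, hy⟩ := exists_twoValued_of_not_le hxy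
    exact bot_ne_top (α := L) (by rw [← hx, ← h e he, hy])

/-- An element without complement lies strictly between two comparable prime ideals: a prime ideal
above the element `c` and everything disjoint from `c` contains one that omits `c`. -/
lemma exists_twoValued_pair (hL : ¬ ComplementedLattice L) :
    ∃ p q : BoundedLatticeHom L L, TwoValued p ∧ TwoValued q ∧ (∀ z, p z ≤ q z) ∧
      ∃ c, p c = ⊥ ∧ q c = ⊤ := by
  obtain ⟨c, hc⟩ : ∃ c : L, ¬ ∃ b, IsCompl c b := by
    by_contra! h
    exact hL ⟨h⟩
  have hI : Order.IsIdeal {z : L | ∃ y, c ⊓ y = ⊥ ∧ z ≤ c ⊔ y} :=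
    { IsLowerSet := fun _ _ hba ⟨y, hy, hay⟩ => ⟨y, hy, hba.trans hay⟩
      Nonempty := ⟨⊥, ⊥, by simp, bot_le⟩
      Directed := by
        rintro a ⟨y, hy, ha⟩ b ⟨y', hy', hb⟩
        refine ⟨a ⊔ b, ⟨y ⊔ y', by rw [inf_sup_left, hy, hy', sup_bot_eq], ?_⟩,
          le_sup_left, le_sup_right⟩
        exact sup_le (ha.trans (sup_le_sup_left le_sup_left c))
          (hb.trans (sup_le_sup_left le_sup_right c)) }
  obtain ⟨J, hJ, hIJ, -⟩ := DistribLattice.prime_ideal_of_disjoint_filter_ideal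
    (F := Order.PFilter.principal (⊤ : L)) (I := hI.toIdeal)
    (Set.disjoint_left.2 fun z hz ⟨y, hy, hzy⟩ => hc ⟨y, disjoint_iff.2 hy,
      codisjoint_iff.2 (top_le_iff.1 (le_trans hz hzy))⟩)
  have hmem : ∀ y, c ⊓ y = ⊥ → c ⊔ y ∈ J := fun y hy => hIJ ⟨y, hy, le_rfl⟩
  have hF : Order.IsPFilter {z : L | ∃ y, y ∉ J ∧ c ⊓ y ≤ z} := by
    refine Order.IsPFilter.of_def ⟨⊤, ⊤, hJ.toIsProper.top_notMem, le_top⟩ ?_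
      (fun hxy ⟨w, hw, hwx⟩ => ⟨w, hw, hwx.trans hxy⟩)
    rintro a ⟨y, hy, ha⟩ b ⟨y', hy', hb⟩
    refine ⟨a ⊓ b, ⟨y ⊓ y', fun h => (hJ.mem_or_mem h).elim hy hy', ?_⟩,
      inf_le_left, inf_le_right⟩
    exact le_inf ((inf_le_inf_left c inf_le_left).trans ha)
      ((inf_le_inf_left c inf_le_right).trans hb)
  obtain ⟨K, hK, -, hKd⟩ := DistribLattice.prime_ideal_of_disjoint_filter_ideal
    (F := hF.toPFilter) (I := Order.Ideal.principal (⊥ : L))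
    (Set.disjoint_left.2 fun z ⟨y, hy, hyz⟩ hz => hy
      (J.lower le_sup_right (hmem y (le_bot_iff.1 (le_trans hyz hz)))))
  have hcJ : c ∈ J := J.lower le_sup_left (hmem ⊥ (inf_bot_eq c))
  have hcK : c ∉ K := Set.disjoint_left.1 hKd
    (show c ∈ {z : L | ∃ y, y ∉ J ∧ c ⊓ y ≤ z} from ⟨⊤, hJ.toIsProper.top_notMem, inf_le_left⟩)
  have hKJ : ∀ z, z ∈ K → z ∈ J := fun z hz => by
    by_contra hzJ
    exact Set.disjoint_left.1 hKd
      (show z ∈ {z : L | ∃ y, y ∉ J ∧ c ⊓ y ≤ z} from ⟨z, hzJ, inf_le_right⟩) hz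
  refine ⟨ofPrime J hJ, ofPrime K hK, twoValued_ofPrime J hJ, twoValued_ofPrime K hK, fun z => ?_,
    c, by simp [ofPrime_apply, hcJ], by simp [ofPrime_apply, hcK]⟩
  by_cases hz : z ∈ K
  · simp [ofPrime_apply, hz, hKJ z hz]
  · simp [ofPrime_apply, hz]

end TwoValued

/-! ### Compactness -/

section Compactness

/-- Separation of compact sets by a lattice of clopen sets, given separation of points. The
hypotheses `h₁` and `h₀` replace the empty meet and the empty join, which need not exist. -/
lemma exists_separating {X A : Type*} [TopologicalSpace X] [Nonempty A] (S : A → Set X)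
    (hS : ∀ a, IsClopen (S a)) (hsup : ∀ a b, ∃ c, S c = S a ∪ S b)
    (hinf : ∀ a b, ∃ c, S c = S a ∩ S b) {K₀ K₁ : Set X} (hK₀ : IsCompact K₀)
    (hK₁ : IsCompact K₁) (h₁ : ∀ x ∈ K₁, ∃ a, x ∈ S a) (h₀ : ∀ y ∈ K₀, ∃ a, y ∉ S a)
    (hsep : ∀ x ∈ K₁, ∀ y ∈ K₀, ∃ a, x ∈ S a ∧ y ∉ S a) :
    ∃ a, (∀ x ∈ K₁, x ∈ S a) ∧ ∀ y ∈ K₀, y ∉ S a := by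
  have hbot : ∃ a, ∀ y ∈ K₀, y ∉ S a := by
    refine hK₀.induction_on (p := fun s => ∃ a, ∀ y ∈ s, y ∉ S a) ?_ ?_ ?_ ?_
    · obtain ⟨a⟩ := ‹Nonempty A›
      exact ⟨a, by simp⟩
    · exact fun s t hst ⟨a, ha⟩ => ⟨a, fun y hy => ha y (hst hy)⟩
    · rintro s t ⟨a, ha⟩ ⟨b, hb⟩
      obtain ⟨c, hc⟩ := hinf a b
      refine ⟨c, fun y hy hyc => ?_⟩
      rw [hc] at hyc
      exact hy.elim (fun h => ha y h hyc.1) (fun h => hb y h hyc.2)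
    · intro y hy
      obtain ⟨a, ha⟩ := h₀ y hy
      exact ⟨(S a)ᶜ, mem_nhdsWithin_of_mem_nhds ((hS a).compl.isOpen.mem_nhds ha), a,
        fun _ h => h⟩
  have hpt : ∀ x ∈ K₁, ∃ a, x ∈ S a ∧ ∀ y ∈ K₀, y ∉ S a := by
    intro x hx
    refine hK₀.induction_on (p := fun s => ∃ a, x ∈ S a ∧ ∀ y ∈ s, y ∉ S a) ?_ ?_ ?_ ?_
    · obtain ⟨a, ha⟩ := h₁ x hx
      exact ⟨a, ha, by simp⟩
    · exact fun s t hst ⟨a, hxa, ha⟩ => ⟨a, hxa, fun y hy => ha y (hst hy)⟩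
    · rintro s t ⟨a, hxa, ha⟩ ⟨b, hxb, hb⟩
      obtain ⟨c, hc⟩ := hinf a b
      refine ⟨c, hc ▸ ⟨hxa, hxb⟩, fun y hy hyc => ?_⟩
      rw [hc] at hyc
      exact hy.elim (fun h => ha y h hyc.1) (fun h => hb y h hyc.2)
    · intro y hy
      obtain ⟨a, hxa, ha⟩ := hsep x hx y hy
      exact ⟨(S a)ᶜ, mem_nhdsWithin_of_mem_nhds ((hS a).compl.isOpen.mem_nhds ha), a, hxa,
        fun _ h => h⟩
  refine hK₁.induction_on (p := fun s => ∃ a, (∀ x ∈ s, x ∈ S a) ∧ ∀ y ∈ K₀, y ∉ S a) ?_ ?_ ?_ ?_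
  · obtain ⟨a, ha⟩ := hbot
    exact ⟨a, by simp, ha⟩
  · exact fun s t hst ⟨a, ha, ha'⟩ => ⟨a, fun x hx => ha x (hst hx), ha'⟩
  · rintro s t ⟨a, ha, ha'⟩ ⟨b, hb, hb'⟩
    obtain ⟨c, hc⟩ := hsup a b
    refine ⟨c, fun x hx => ?_, fun y hy hyc => ?_⟩
    · rw [hc]
      exact hx.imp (ha x) (hb x)
    · rw [hc] at hyc
      exact hyc.elim (ha' y hy) (hb' y hy)
  · intro x hx
    obtain ⟨a, hxa, ha⟩ := hpt x hx
    exact ⟨S a, mem_nhdsWithin_of_mem_nhds ((hS a).isOpen.mem_nhds hxa), a, fun _ h => h, ha⟩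

variable {ℒ : FirstOrder.Language.{0, 0}} {M A : Type u} [ℒ.Structure M] [ℒ.Structure A]

lemma continuous_dual_apply (a : A) :
    @Continuous (A →[ℒ] M) M (dualTopology ℒ M A) ⊥ fun h => h a := by
  let _ : TopologicalSpace M := ⊥
  let _ : TopologicalSpace (A →[ℒ] M) := dualTopology ℒ M A
  exact (continuous_apply a).comp continuous_induced_dom

/-- `D(A)` is a closed subspace of `M ^ A`, so it is compact. -/
lemma compactSpace_dual [ℒ.IsAlgebraic] [Finite M] :
    @CompactSpace (A →[ℒ] M) (dualTopology ℒ M A) := by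
  let _ : TopologicalSpace M := ⊥
  have : DiscreteTopology M := ⟨rfl⟩
  let _ : TopologicalSpace (A →[ℒ] M) := dualTopology ℒ M A
  have hind : Topology.IsInducing (fun (h : A →[ℒ] M) (a : A) => h a) := ⟨rfl⟩
  have hrange : Set.range (fun (h : A →[ℒ] M) (a : A) => h a) =
      ⋂ (n : ℕ) (f : ℒ.Functions n) (x : Fin n → A),
        {g : A → M | g (funMap f x) = funMap f fun i => g (x i)} := by
    ext g
    simp only [Set.mem_range, Set.mem_iInter, Set.mem_ofPred_eq]
    constructor
    · rintro ⟨h, rfl⟩ n f x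
      exact h.map_fun f x
    · intro hg
      exact ⟨⟨g, fun f x => hg _ f x, fun r => isEmptyElim r⟩, rfl⟩
  refine ⟨?_⟩
  rw [hind.isCompact_iff, Set.image_univ, hrange]
  refine IsClosed.isCompact (isClosed_iInter fun n => isClosed_iInter fun f =>
    isClosed_iInter fun x => isClosed_eq (continuous_apply _) ?_)
  exact (continuous_of_discreteTopology (f := fun y : Fin n → M => funMap f y)).comp
    (continuous_pi fun i => continuous_apply (x i))

end Compactness

/-! ### Double duals -/

section DoubleDual

variable {ℒ : FirstOrder.Language.{0, 0}} {M : Type u} [ℒ.Structure M]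

lemma eval_mem_doubleDual (R : Set (FinRel M)) {A : Type u} [ℒ.Structure A] (a : A) :
    (fun h : A →[ℒ] M => h a) ∈ doubleDual ℒ R A :=
  ⟨continuous_dual_apply a, fun _ _ _ hx => hx a⟩

/-- Only surjectivity of the evaluation maps depends on the set of relations. -/
lemma evaluationsBijective_iff {R : Set (FinRel M)} :
    EvaluationsBijective ℒ R ↔ ∀ (A : Type u) [ℒ.Structure A] [Nonempty A], InISP ℒ M A →
      ∀ φ ∈ doubleDual ℒ R A, ∃ a : A, ∀ h : A →[ℒ] M, φ h = h a := by
  constructor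
  · intro hR A _ _ hA φ hφ
    obtain ⟨a, -, rfl⟩ := (hR A hA).surjOn hφ
    exact ⟨a, fun h => rfl⟩
  · intro hR A _ _ hA
    refine ⟨fun a _ => eval_mem_doubleDual R a, fun a _ b _ hab => ?_, fun φ hφ => ?_⟩
    · obtain ⟨I, ⟨ι⟩⟩ := hA
      refine ι.injective (funext fun i => ?_)
      -- the `i`-th coordinate of the embedding is a homomorphism `A → M`
      let h : A →[ℒ] M :=
        ⟨fun a => ι a i, fun f x => congrFun (ι.map_fun f x) i,
          fun r x hx => ((ι.map_rel r x).2 hx) i⟩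
      exact congrFun hab h
    · obtain ⟨a, ha⟩ := hR A hA φ hφ
      exact ⟨a, trivial, (funext ha).symm⟩

/-- A map preserves the graph of a unary operation if and only if it commutes with it. -/
lemma preserves_unaryGraph_iff {A : Type u} [ℒ.Structure A] {φ : (A →[ℒ] M) → M} {g : M → M} :
    Preserves ℒ φ (unaryGraph g) ↔
      ∀ x y : A →[ℒ] M, (∀ a, y a = g (x a)) → φ y = g (φ x) :=
  ⟨fun H x y hxy => H ![x, y] hxy, fun H x hx => H (x 0) (x 1) hx⟩

lemma preserves_constGraph_iff {A : Type u} [ℒ.Structure A] {φ : (A →[ℒ] M) → M} {c : M} :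
    Preserves ℒ φ (constGraph c) ↔ ∀ x : A →[ℒ] M, (∀ a, x a = c) → φ x = c :=
  ⟨fun H x hx => H ![x] hx, fun H x hx => H (x 0) hx⟩

lemma isAlgebraicRel_unaryGraph (e : M →[ℒ] M) : IsAlgebraicRel ℒ (unaryGraph e) := by
  refine ⟨⟨{v : Fin 2 → M | v 1 = e (v 0)}, ?_⟩, rfl⟩
  intro n f x hx
  change funMap f (fun j => x j 1) = e (funMap f fun j => x j 0)
  rw [e.map_fun]
  exact congrArg (funMap f) (funext hx)

/-- A set of relations that is implied by the endomorphisms can be replaced by them. -/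
lemma EvaluationsBijective.endodualisable {R : Set (FinRel M)} (hR : EvaluationsBijective ℒ R)
    (hend : ∀ (A : Type u) [ℒ.Structure A] (φ : (A →[ℒ] M) → M),
      (∀ e : M →[ℒ] M, Preserves ℒ φ (unaryGraph e)) → ∀ r ∈ R, Preserves ℒ φ r) :
    Endodualisable ℒ M := by
  refine ⟨?_, evaluationsBijective_iff.2 fun A _ _ hA φ hφ =>
    evaluationsBijective_iff.1 hR A hA φ ⟨hφ.1, hend A φ fun e => hφ.2 _ ⟨e, rfl⟩⟩⟩
  rintro r ⟨e, rfl⟩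
  exact isAlgebraicRel_unaryGraph e

lemma isAlgebraicRel_of_mem_retractionGraphs {S : Set M} {r : FinRel M}
    (hr : r ∈ retractionGraphs ℒ S) : IsAlgebraicRel ℒ r := by
  obtain ⟨e, -, -, rfl⟩ := hr
  exact isAlgebraicRel_unaryGraph e

/-- The algebra of `k`-ary term functions of `M`, as a subalgebra of `M ^ (M ^ k)`. -/
def termFunctions (ℒ : FirstOrder.Language.{0, 0}) (M : Type u) [ℒ.Structure M] (k : ℕ) :
    ℒ.Substructure ((Fin k → M) → M) where
  carrier := {f | IsTermFunction ℒ f}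
  fun_mem f x hx := by
    choose t ht using hx
    refine ⟨.func f t, fun v => ?_⟩
    rw [FirstOrder.Language.Term.realize_func]
    exact congrArg (funMap f) (funext fun i => ht i v)

/-- The dual of the algebra of `k`-ary term functions is `M ^ k`. An `End`-preserving function
`f : M ^ k → M` is therefore an element of the double dual, that is, a term function. -/
lemma Endodualisable.endoprimal (hM : Endodualisable ℒ M) : Endoprimal ℒ M := by
  intro k hk f hf
  let π (i : Fin k) : termFunctions ℒ M k := ⟨fun v => v i, .var i, fun v => rfl⟩
  have : Nonempty (termFunctions ℒ M k) := ⟨π ⟨0, hk⟩⟩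
  obtain ⟨a, ha⟩ := evaluationsBijective_iff.1 hM.2 (termFunctions ℒ M k)
    ⟨Fin k → M, ⟨(termFunctions ℒ M k).subtype⟩⟩ (fun x => f fun i => x (π i)) (by
      refine ⟨?_, ?_⟩
      · let _ : TopologicalSpace M := ⊥
        have : DiscreteTopology M := ⟨rfl⟩
        let _ : TopologicalSpace (termFunctions ℒ M k →[ℒ] M) := dualTopology ℒ M _
        exact (continuous_of_discreteTopology (f := f)).comp
          (continuous_pi fun i => continuous_dual_apply (π i))
      · rintro r ⟨e, rfl⟩
        refine preserves_unaryGraph_iff.2 fun x y hxy => ?_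
        simp only [hxy]
        exact hf e _)
  obtain ⟨t, ht⟩ := a.2
  refine ⟨t, fun v => ?_⟩
  -- the point of the dual that corresponds to `v` is evaluation at `v`
  let x : termFunctions ℒ M k →[ℒ] M :=
    ⟨fun g => g.1 v, fun f x => rfl, fun r x hx => hx v⟩
  exact (ha x).trans (ht v)

end DoubleDual

/-! ### The duality for lattices that are not Boolean -/

/-- The basic operations of the algebra `L` include `⊔` and `⊓`, and all of them commute with
the endomorphisms of the bounded lattice `L`. -/
structure IsLatticeReduct (ℒ : FirstOrder.Language.{0, 0}) (L : Type u) [DistribLattice L]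
    [BoundedOrder L] [ℒ.Structure L] : Prop where
  exists_sup : ∃ s : ℒ.Functions 2, ∀ v : Fin 2 → L, funMap s v = v 0 ⊔ v 1
  exists_inf : ∃ s : ℒ.Functions 2, ∀ v : Fin 2 → L, funMap s v = v 0 ⊓ v 1
  map_funMap : ∀ (e : BoundedLatticeHom L L) {n : ℕ} (f : ℒ.Functions n) (x : Fin n → L),
    e (funMap f x) = funMap f fun i => e (x i)

section Duality

variable {ℒ : FirstOrder.Language.{0, 0}} [ℒ.IsAlgebraic] {L : Type u} [DistribLattice L]
  [BoundedOrder L] [ℒ.Structure L]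

/-- An endomorphism of the bounded lattice `L` as an endomorphism of a reduct. -/
def IsLatticeReduct.toHom (hℒ : IsLatticeReduct ℒ L) (e : BoundedLatticeHom L L) : L →[ℒ] L :=
  ⟨e, fun f x => hℒ.map_funMap e f x, fun r => isEmptyElim r⟩

lemma IsLatticeReduct.map_of_mem_doubleDual (hℒ : IsLatticeReduct ℒ L) {A : Type u}
    [ℒ.Structure A] {φ : (A →[ℒ] L) → L}
    (hφ : ∀ r ∈ retractionGraphs ℒ ({⊥, ⊤} : Set L), Preserves ℒ φ r)
    {e : BoundedLatticeHom L L} (he : TwoValued e) {x y : A →[ℒ] L}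
    (hxy : ∀ a, y a = e (x a)) : φ y = e (φ x) := by
  refine preserves_unaryGraph_iff.1 (hφ _ ⟨hℒ.toHom e, fun z => he.apply_apply e z, ?_, rfl⟩)
    x y hxy
  ext z
  constructor
  · rintro ⟨w, rfl⟩
    exact he w
  · rintro (rfl | rfl)
    · exact ⟨⊥, map_bot e⟩
    · exact ⟨⊤, map_top e⟩

/-- The order between two-valued homomorphisms `h ≤ h'` is witnessed by the homomorphism
`h ⊔ (c ⊓ h')` into the chain `⊥ < c < ⊤`. -/
lemma IsLatticeReduct.map_le_map_of_le [Nontrivial L] (hℒ : IsLatticeReduct ℒ L)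
    (hL : ¬ ComplementedLattice L) {A : Type u} [ℒ.Structure A] {φ : (A →[ℒ] L) → L}
    (hφ : ∀ r ∈ retractionGraphs ℒ ({⊥, ⊤} : Set L), Preserves ℒ φ r) {h h' : A →[ℒ] L}
    (hh : ∀ a, h a = ⊥ ∨ h a = ⊤) (hh' : ∀ a, h' a = ⊥ ∨ h' a = ⊤) (hle : ∀ a, h a ≤ h' a) :
    φ h ≤ φ h' := by
  obtain ⟨p, q, hp, hq, hpq, c, hpc, hqc⟩ := exists_twoValued_pair hL
  have fixed {z : L} (hz : z = ⊥ ∨ z = ⊤) (r : BoundedLatticeHom L L) : r z = z := by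
    rcases hz with rfl | rfl <;> simp
  have hbot {r : BoundedLatticeHom L L} (hr : r c = ⊥) (a : A) : r (h a ⊔ c ⊓ h' a) = h a := by
    rw [map_sup, map_inf, hr, fixed (hh a), bot_inf_eq, sup_bot_eq]
  have htop {r : BoundedLatticeHom L L} (hr : r c = ⊤) (a : A) : r (h a ⊔ c ⊓ h' a) = h' a := by
    rw [map_sup, map_inf, hr, fixed (hh a), fixed (hh' a), top_inf_eq, sup_eq_right.2 (hle a)]
  let x : A →[ℒ] L := ⟨fun a => h a ⊔ c ⊓ h' a, fun f v => by
    -- composed with any two-valued homomorphism, the map is `h` or `h'`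
    refine eq_of_forall_twoValued (fun r hr => ?_)
    rw [hℒ.map_funMap]
    rcases hr c with hrc | hrc
    · rw [hbot hrc, h.map_fun]
      exact congrArg (funMap f) (funext fun i => (hbot hrc (v i)).symm)
    · rw [htop hrc, h'.map_fun]
      exact congrArg (funMap f) (funext fun i => (htop hrc (v i)).symm),
    fun r => isEmptyElim r⟩
  rw [hℒ.map_of_mem_doubleDual hφ hp (x := x) fun a => (hbot hpc a).symm,
    hℒ.map_of_mem_doubleDual hφ hq (x := x) fun a => (htop hqc a).symm]
  exact hpq _

/-- If `L` is not Boolean, then its retractions onto `{⊥, ⊤}` and the constants `⊥`, `⊤` represent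
the class generated by any reduct that has `⊔` and `⊓` as basic operations. -/
theorem IsLatticeReduct.evaluationsBijective_of_not_complementedLattice [Finite L] [Nontrivial L]
    (hℒ : IsLatticeReduct ℒ L) (hL : ¬ ComplementedLattice L) :
    EvaluationsBijective ℒ (retractionGraphs ℒ ({⊥, ⊤} : Set L) ∪
      {constGraph ⊥, constGraph ⊤}) := by
  refine evaluationsBijective_iff.2 fun A _ _ hA φ ⟨hcont, hpres⟩ => ?_
  have hφ : ∀ r ∈ retractionGraphs ℒ ({⊥, ⊤} : Set L), Preserves ℒ φ r :=
    fun r hr => hpres r (Or.inl hr)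
  have hφbot := preserves_constGraph_iff.1 (hpres (constGraph ⊥) (by simp))
  have hφtop := preserves_constGraph_iff.1 (hpres (constGraph ⊤) (by simp))
  obtain ⟨p, hp⟩ : ∃ p : BoundedLatticeHom L L, TwoValued p := by
    obtain ⟨p, -, hp, -⟩ := exists_twoValued_pair hL
    exact ⟨p, hp⟩
  let _ : TopologicalSpace L := ⊥
  have : DiscreteTopology L := ⟨rfl⟩
  let _ : TopologicalSpace (A →[ℒ] L) := dualTopology ℒ L A
  have : CompactSpace (A →[ℒ] L) := compactSpace_dual
  have hclopen {g : (A →[ℒ] L) → L} (hg : Continuous g) (z : L) : IsClopen {h | p (g h) = z} :=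
    (isClopen_discrete ({w | p w = z} : Set L)).preimage hg
  have hcomp (e : BoundedLatticeHom L L) (he : TwoValued e) (h : A →[ℒ] L) :
      φ ((hℒ.toHom e).comp h) = e (φ h) :=
    hℒ.map_of_mem_doubleDual hφ he fun _ => rfl
  have hne {z : L} : p z ≠ ⊤ ↔ p z = ⊥ := by
    rcases hp z with h | h <;> simp [h, bot_ne_top, bot_ne_top.symm]
  -- On `D(A)`, the maps `p ∘ φ` and `h ↦ p (h a)` are compared through the sets where they are `⊤`.
  obtain ⟨a, ha₁, ha₀⟩ := exists_separating (fun (a : A) => {h : A →[ℒ] L | p (h a) = ⊤})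
    (fun a => hclopen (continuous_dual_apply a) ⊤) (K₀ := {h | p (φ h) = ⊥})
    (K₁ := {h | p (φ h) = ⊤})
    (by
      intro a b
      obtain ⟨s, hs⟩ := hℒ.exists_sup
      refine ⟨funMap s ![a, b], Set.ext fun h => ?_⟩
      have : h (funMap s ![a, b]) = h a ⊔ h b := (h.map_fun s _).trans (hs _)
      simp only [Set.mem_ofPred_eq, Set.mem_union, this, map_sup]
      rcases hp (h a) with h1 | h1 <;> simp [h1])
    (by
      intro a b
      obtain ⟨s, hs⟩ := hℒ.exists_inf
      refine ⟨funMap s ![a, b], Set.ext fun h => ?_⟩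
      have : h (funMap s ![a, b]) = h a ⊓ h b := (h.map_fun s _).trans (hs _)
      simp only [Set.mem_ofPred_eq, Set.mem_inter_iff, this, map_inf, inf_eq_top_iff])
    (hclopen hcont ⊥).isClosed.isCompact (hclopen hcont ⊤).isClosed.isCompact
    (by
      intro h hh
      by_contra! hno
      have := hφbot ((hℒ.toHom p).comp h) fun a => hne.1 (hno a)
      rw [hcomp p hp] at this
      exact bot_ne_top (this.symm.trans hh))
    (by
      intro h hh
      by_contra! hno
      have := hφtop ((hℒ.toHom p).comp h) fun a => hno a
      rw [hcomp p hp] at this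
      exact bot_ne_top (hh.symm.trans this))
    (by
      intro h hh h' hh'
      by_contra! hno
      have := hℒ.map_le_map_of_le hL hφ (h := (hℒ.toHom p).comp h) (h' := (hℒ.toHom p).comp h')
        (fun a => hp (h a)) (fun a => hp (h' a)) (fun a => by
          change p (h a) ≤ p (h' a)
          rcases hp (h a) with h1 | h1
          · exact h1 ▸ bot_le
          · exact (hno a h1).symm ▸ le_top)
      rw [hcomp p hp, hcomp p hp, show p (φ h) = ⊤ from hh, show p (φ h') = ⊥ from hh'] at this
      exact bot_ne_top (le_bot_iff.1 this).symm)
  have hpa (h : A →[ℒ] L) : p (φ h) = p (h a) := by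
    rcases hp (φ h) with h1 | h1
    · rw [h1, hne.1 (ha₀ h h1)]
    · rw [h1, ha₁ h h1]
  refine ⟨a, fun h => eq_of_forall_twoValued (fun q hq => ?_)⟩
  calc q (φ h) = p (q (φ h)) := (hq.apply_apply p _).symm
    _ = p (φ ((hℒ.toHom q).comp h)) := by rw [hcomp q hq]
    _ = p (q (h a)) := hpa _
    _ = q (h a) := hq.apply_apply p _

end Duality

/-! ### Boolean lattices -/

lemma monotone_of_isTermFunction {ℒ : FirstOrder.Language.{0, 0}} {M : Type u} [Preorder M]
    [ℒ.Structure M] (hM : ∀ {n : ℕ} (f : ℒ.Functions n), Monotone (funMap f : (Fin n → M) → M))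
    {k : ℕ} {g : (Fin k → M) → M} (hg : IsTermFunction ℒ g) : Monotone g := by
  obtain ⟨t, ht⟩ := hg
  intro v w hvw
  rw [ht, ht]
  clear ht
  induction t with
  | var i => exact hvw i
  | func f ts ih => exact hM f ih

section Boolean

instance isAlgebraic_latLang : latLang.IsAlgebraic := fun _ => inferInstanceAs (IsEmpty Empty)

instance isAlgebraic_bddLatLang : bddLatLang.IsAlgebraic :=
  fun _ => inferInstanceAs (IsEmpty Empty)

lemma monotone_funMap_latLang {L : Type u} [Lattice L] {n : ℕ} (f : latLang.Functions n) :
    Monotone (funMap f : (Fin n → L) → L) := by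
  intro v w hvw
  cases f with
  | sup => exact sup_le_sup (hvw 0) (hvw 1)
  | inf => exact inf_le_inf (hvw 0) (hvw 1)

lemma monotone_funMap_bddLatLang {L : Type u} [Lattice L] [BoundedOrder L] {n : ℕ}
    (f : bddLatLang.Functions n) : Monotone (funMap f : (Fin n → L) → L) := by
  intro v w hvw
  cases f with
  | sup => exact sup_le_sup (hvw 0) (hvw 1)
  | inf => exact inf_le_inf (hvw 0) (hvw 1)
  | zero => exact le_rfl
  | one => exact le_rfl

variable {L : Type u} [DistribLattice L] [BoundedOrder L]

lemma isLatticeReduct_latLang : IsLatticeReduct latLang L where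
  exists_sup := ⟨LatFunc.sup, fun _ => rfl⟩
  exists_inf := ⟨LatFunc.inf, fun _ => rfl⟩
  map_funMap e n f x := by
    cases f with
    | sup => exact map_sup e _ _
    | inf => exact map_inf e _ _

lemma isLatticeReduct_bddLatLang : IsLatticeReduct bddLatLang L where
  exists_sup := ⟨BddLatFunc.sup, fun _ => rfl⟩
  exists_inf := ⟨BddLatFunc.inf, fun _ => rfl⟩
  map_funMap e n f x := by
    cases f with
    | sup => exact map_sup e _ _
    | inf => exact map_inf e _ _
    | zero => exact map_bot e
    | one => exact map_top e

/-- The relative complement of the median of `x`, `y`, `z` in the interval between their meet and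
their join; in a Boolean lattice this is `x + y + z`. -/
lemma exists_relative_compl_median [ComplementedLattice L] (x y z : L) :
    ∃ w, w ⊓ (x ⊓ y ⊔ y ⊓ z ⊔ z ⊓ x) = x ⊓ y ⊓ z ∧
      w ⊔ (x ⊓ y ⊔ y ⊓ z ⊔ z ⊓ x) = x ⊔ y ⊔ z := by
  set m := x ⊓ y ⊔ y ⊓ z ⊔ z ⊓ x
  have hkm : x ⊓ y ⊓ z ≤ m := inf_le_left.trans (le_sup_left.trans le_sup_left)
  have hmj : m ≤ x ⊔ y ⊔ z :=
    sup_le (sup_le (inf_le_left.trans (le_sup_left.trans le_sup_left)) (inf_le_right.trans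
      le_sup_right)) (inf_le_left.trans le_sup_right)
  obtain ⟨n, hn⟩ := exists_isCompl m
  refine ⟨x ⊓ y ⊓ z ⊔ n ⊓ (x ⊔ y ⊔ z), ?_, ?_⟩
  · rw [inf_sup_right, inf_right_comm n, inf_comm n, hn.inf_eq_bot, bot_inf_eq, sup_bot_eq,
      inf_eq_left.2 hkm]
  · rw [sup_right_comm, sup_eq_right.2 hkm, sup_inf_left, hn.sup_eq_top, top_inf_eq,
      sup_eq_right.2 hmj]

/-- In a Boolean lattice `x + y + z` commutes with all lattice endomorphisms, since it is
determined by lattice identities, but it is not monotone. -/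
lemma not_kEndoprimal_latLang [Nontrivial L] [ComplementedLattice L] :
    ¬ KEndoprimal latLang 3 L := by
  intro hL
  choose g hg₁ hg₂ using exists_relative_compl_median (L := L)
  have hmono := monotone_of_isTermFunction monotone_funMap_latLang
    (hL (fun v => g (v 0) (v 1) (v 2)) (by
      intro e v
      have hsup (a b : L) : e (a ⊔ b) = e a ⊔ e b := e.map_fun LatFunc.sup ![a, b]
      have hinf (a b : L) : e (a ⊓ b) = e a ⊓ e b := e.map_fun LatFunc.inf ![a, b]
      refine eq_of_inf_eq_sup_eq (a := e (v 0 ⊓ v 1 ⊔ v 1 ⊓ v 2 ⊔ v 2 ⊓ v 0)) ?_ ?_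
      · rw [← hinf, hg₁]
        simp only [hsup, hinf, hg₁]
      · rw [← hsup, hg₂]
        simp only [hsup, hinf, hg₂]))
  have h1 : g ⊤ ⊥ ⊥ = ⊤ := by simpa using hg₂ ⊤ ⊥ ⊥
  have h2 : g ⊤ ⊤ ⊥ = ⊥ := by simpa using hg₁ ⊤ ⊤ ⊥
  have hle : g ⊤ ⊥ ⊥ ≤ g ⊤ ⊤ ⊥ := hmono (a := ![⊤, ⊥, ⊥]) (b := ![⊤, ⊤, ⊥]) (by
    intro i
    fin_cases i <;> simp)
  rw [h1, h2] at hle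
  exact bot_ne_top (le_bot_iff.1 hle).symm

lemma not_kEndoprimal_bddLatLang [Nontrivial L] [ComplementedLattice L] :
    ¬ KEndoprimal bddLatLang 1 L := by
  intro hL
  choose g hg using exists_isCompl (α := L)
  have hmono := monotone_of_isTermFunction monotone_funMap_bddLatLang
    (hL (fun v => g (v 0)) (by
      intro e v
      have hsup (a b : L) : e (a ⊔ b) = e a ⊔ e b := e.map_fun BddLatFunc.sup ![a, b]
      have hinf (a b : L) : e (a ⊓ b) = e a ⊓ e b := e.map_fun BddLatFunc.inf ![a, b]
      have hbot : e (⊥ : L) = ⊥ := e.map_fun BddLatFunc.zero ![]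
      have htop : e (⊤ : L) = ⊤ := e.map_fun BddLatFunc.one ![]
      refine (hg (e (v 0))).right_unique ⟨disjoint_iff.2 ?_, codisjoint_iff.2 ?_⟩
      · rw [← hinf, (hg (v 0)).inf_eq_bot, hbot]
      · rw [← hsup, (hg (v 0)).sup_eq_top, htop]))
  have h1 : g ⊥ = ⊤ := by simpa using (hg ⊥).sup_eq_top
  have h2 : g ⊤ = ⊥ := by simpa using (hg ⊤).inf_eq_bot
  have hle : g ⊥ ≤ g ⊤ := hmono (a := fun _ => ⊥) (b := fun _ => ⊤) fun _ => bot_le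
  rw [h1, h2] at hle
  exact bot_ne_top (le_bot_iff.1 hle).symm

end Boolean

/-! ### Constants -/

section Constants

variable {L : Type u}

/-- In the signature without constants, every constant map is an endomorphism. -/
def constHom [Lattice L] (c : L) : L →[latLang] L :=
  ⟨fun _ => c, fun f x => by
    cases f with
    | sup => exact (sup_idem c).symm
    | inf => exact (inf_idem c).symm,
    fun r => isEmptyElim r⟩

lemma isAlgebraicRel_constGraph [Lattice L] (c : L) : IsAlgebraicRel latLang (constGraph c) := by
  refine ⟨⟨{v : Fin 1 → L | v 0 = c}, ?_⟩, rfl⟩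
  intro n f x hx
  change funMap f (fun j => x j 0) = c
  rw [show (fun j => x j 0) = fun _ => c from funext hx]
  exact ((constHom c).map_fun f fun _ => c).symm

lemma preserves_constGraph_of_preserves_end [Lattice L] {A : Type u}
    [latLang.Structure A] {φ : (A →[latLang] L) → L}
    (hφ : ∀ e : L →[latLang] L, Preserves latLang φ (unaryGraph e)) (c : L) :
    Preserves latLang φ (constGraph c) :=
  preserves_constGraph_iff.2 fun x hx => preserves_unaryGraph_iff.1 (hφ (constHom c)) x x hx

/-- For bounded lattices, preservation of the constants `⊥` and `⊤` is a vacuous condition: no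
homomorphism into a nontrivial `L` is constant. -/
lemma preserves_constGraph_bddLatLang [Lattice L] [BoundedOrder L] [Nontrivial L] {A : Type u}
    [bddLatLang.Structure A] (φ : (A →[bddLatLang] L) → L) :
    Preserves bddLatLang φ (constGraph ⊥) ∧ Preserves bddLatLang φ (constGraph ⊤) := by
  have hbot (x : A →[bddLatLang] L) : x (funMap (L := bddLatLang) BddLatFunc.zero ![]) = ⊥ :=
    x.map_fun (L := bddLatLang) BddLatFunc.zero ![]
  have htop (x : A →[bddLatLang] L) : x (funMap (L := bddLatLang) BddLatFunc.one ![]) = ⊤ :=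
    x.map_fun (L := bddLatLang) BddLatFunc.one ![]
  exact ⟨preserves_constGraph_iff.2 fun x hx => absurd ((hx _).symm.trans (htop x)) bot_ne_top,
    preserves_constGraph_iff.2 fun x hx => absurd ((hbot x).symm.trans (hx _)) bot_ne_top⟩

end Constants

end NaturalDuality

/-- A finite lattice `L` has a least element `0 = ⊥` and a greatest element `1 = ⊤`; the instance
`BoundedOrder L` only names them. The first part is about the algebra `(L; ∨, ∧)`, the second
about `(L; ∨, ∧, 0, 1)`. The constants `0`, `1` are not algebraic over the latter, so there the
fourth condition is stated both for the retractions alone and, with the constants adjoined, as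
bijectivity of the evaluation maps. -/
theorem mainTheorem4 (L : Type*) [DistribLattice L] [BoundedOrder L] [Finite L]
    [Nontrivial L] :
    List.TFAE
      [NaturalDuality.KEndoprimal NaturalDuality.latLang 3 L,
       NaturalDuality.Endoprimal NaturalDuality.latLang L,
       NaturalDuality.Endodualisable NaturalDuality.latLang L,
       NaturalDuality.YieldsDuality NaturalDuality.latLang
         (NaturalDuality.retractionGraphs NaturalDuality.latLang ({⊥, ⊤} : Set L) ∪
           {NaturalDuality.constGraph ⊥, NaturalDuality.constGraph ⊤}),
       ¬ ComplementedLattice L] ∧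
    List.TFAE
      [NaturalDuality.KEndoprimal NaturalDuality.bddLatLang 1 L,
       NaturalDuality.Endoprimal NaturalDuality.bddLatLang L,
       NaturalDuality.Endodualisable NaturalDuality.bddLatLang L,
       NaturalDuality.YieldsDuality NaturalDuality.bddLatLang
         (NaturalDuality.retractionGraphs NaturalDuality.bddLatLang ({⊥, ⊤} : Set L)),
       NaturalDuality.EvaluationsBijective NaturalDuality.bddLatLang
         (NaturalDuality.retractionGraphs NaturalDuality.bddLatLang ({⊥, ⊤} : Set L) ∪
           {NaturalDuality.constGraph ⊥, NaturalDuality.constGraph ⊤}),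
       ¬ ComplementedLattice L] := by
  open NaturalDuality in
  constructor
  · tfae_have 5 → 4 := fun hL => by
      refine ⟨?_, isLatticeReduct_latLang.evaluationsBijective_of_not_complementedLattice hL⟩
      rintro r (hr | rfl | rfl)
      · exact isAlgebraicRel_of_mem_retractionGraphs hr
      · exact isAlgebraicRel_constGraph ⊥
      · exact isAlgebraicRel_constGraph ⊤
    tfae_have 4 → 3 := fun hR => by
      refine hR.2.endodualisable fun A _ φ hφ => ?_
      rintro r (⟨e, -, -, rfl⟩ | rfl | rfl)
      · exact hφ e
      · exact preserves_constGraph_of_preserves_end hφ ⊥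
      · exact preserves_constGraph_of_preserves_end hφ ⊤
    tfae_have 3 → 2 := Endodualisable.endoprimal
    tfae_have 2 → 1 := fun h => h 3 (by norm_num)
    tfae_have 1 → 5 := fun h _ => not_kEndoprimal_latLang h
    tfae_finish
  · tfae_have 6 → 5 :=
      isLatticeReduct_bddLatLang.evaluationsBijective_of_not_complementedLattice
    tfae_have 5 → 4 := fun hR => by
      refine ⟨fun r => isAlgebraicRel_of_mem_retractionGraphs,
        evaluationsBijective_iff.2 fun A _ _ hA φ hφ =>
          evaluationsBijective_iff.1 hR A hA φ ⟨hφ.1, ?_⟩⟩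
      rintro r (hr | rfl | rfl)
      · exact hφ.2 r hr
      · exact (preserves_constGraph_bddLatLang φ).1
      · exact (preserves_constGraph_bddLatLang φ).2
    tfae_have 4 → 3 := fun hR => by
      refine hR.2.endodualisable fun A _ φ hφ => ?_
      rintro r ⟨e, -, -, rfl⟩
      exact hφ e
    tfae_have 3 → 2 := Endodualisable.endoprimal
    tfae_have 2 → 1 := fun h => h 1 le_rfl
    tfae_have 1 → 6 := fun h _ => not_kEndoprimal_bddLatLang h
    tfae_finish
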